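/- An effect algebra is a set $E$ with constants $0,1$ and a partial operation $+$ such that for all $a,b,c\in E$: (i) $a+b$ is defined iff $b+a$ is, and then $a+b=b+a$; (ii) $a+b$ and $(a+b)+c$ are defined iff $b+c$ and $a+(b+c)$ are, and then $(a+b)+c=a+(b+c)$; (iii) there is a unique $a'\in E$ with $a+a'=1$; (iv) if $a+1$ is defined, then $a=0$. It is partially ordered by $a\le b$ iff $a+c=b$ for some $c\in E$. $E$ has (RDP) if $x_1+x_2=y_1+y_2$ implies that there are $c_{11},c_{12},c_{21},c_{22}\in E$ with $x_1=c_{11}+c_{12}$, $x_2=c_{21}+c_{22}$, $y_1=c_{11}+c_{21}$, $y_2=c_{12}+c_{22}$. It has countable interpolation if, for all sequences $(a_i)$, $(b_j)$ in $E$ with $a_i\le b_j$ for all $i,j$, there is $c\in E$ with $a_i\le c\le b_j$ for all $i,j$. It is monotone $\sigma$-complete if every ascending sequence bounded above in $E$ has a supremum in $E$ and every descending sequence bounded below in $E$ has an infimum in $E$. A state on $E$ is a map $s:E\to[0,1]$ with $s(1)=1$ and $s(a+b)=s(a)+s(b)$ whenever $a+b$ is defined. It is extremal if $s=\lambda s_1+(1-\lambda)s_2$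 with states $s_1,s_2$ and $\lambda\in(0,1)$ implies $s=s_1=s_2$. A $\sigma$-convex combination of a finite or countable family of states $(s_n)$ is a pointwise sum $s=\sum_n\lambda_n s_n$ with $\lambda_n\ge 0$ and $\sum_n\lambda_n=1$. A state $s$ is Jauch–Piron if for all $a,b\in E$ with $s(a)=s(b)=1$ there is $c\in E$ with $c\le a$, $c\le b$ and $s(c)=1$. **Proposition.** Let $E$ be an effect algebra with (RDP). 1. If $E$ is monotone $\sigma$-complete, then $E$ has countable interpolation. 2. If $E$ has countable interpolation (in particular, by 1, if $E$ is monotone $\sigma$-complete), then every $\sigma$-convex combination of extremal states on $E$ is a state on $E$, and it is Jauch–Piron. -/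

import Mathlib

/-- An effect algebra `(E; +, 0, 1)`. The partial operation is `padd : E → E → Option E`:
`padd a b = some c` means that `a + b` is defined and equals `c`, and `padd a b = none` means
that `a + b` is not defined. -/
class EffectAlgebra (E : Type*) extends Zero E, One E where
  /-- The partial addition. -/
  padd : E → E → Option E
  /-- `a + b` is defined iff `b + a` is, and then they are equal. -/
  padd_comm : ∀ a b : E, padd a b = padd b a
  /-- `a + b` and `(a + b) + c` are defined iff `b + c` and `a + (b + c)` are, and then
  `(a + b) + c = a + (b + c)`. -/
  padd_assoc : ∀ a b c : E,
    ((padd a b).bind fun d => padd d c) = ((padd b c).bind fun d => padd a d)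
  /-- Every element has a unique orthosupplement. -/
  existsUnique_compl : ∀ a : E, ∃! a' : E, padd a a' = some 1
  /-- If `a + 1` is defined then `a = 0`. -/
  eq_zero_of_padd_one : ∀ a : E, (padd a 1).isSome → a = 0

namespace EffectAlgebra

section Order

variable {E : Type*} [EffectAlgebra E]

theorem assoc_left {a b c d e : E} (h₁ : padd a b = some d) (h₂ : padd d c = some e) :
    ∃ f, padd b c = some f ∧ padd a f = some e := by
  have h := padd_assoc a b c
  rw [h₁, Option.bind_some, h₂] at h
  exact Option.bind_eq_some_iff.mp h.symm

theorem assoc_right {a b c f e : E} (h₁ : padd b c = some f) (h₂ : padd a f = some e) :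
    ∃ d, padd a b = some d ∧ padd d c = some e := by
  have h := padd_assoc a b c
  rw [h₁, Option.bind_some, h₂] at h
  exact Option.bind_eq_some_iff.mp h

theorem padd_zero (a : E) : padd a 0 = some a := by
  obtain ⟨z, hz, -⟩ := existsUnique_compl (1 : E)
  have hz0 : z = 0 := eq_zero_of_padd_one z (by rw [padd_comm, hz]; rfl)
  rw [hz0] at hz
  obtain ⟨a', ha, -⟩ := existsUnique_compl a
  rw [padd_comm] at ha
  obtain ⟨f, hf, hf'⟩ := assoc_left ha hz
  obtain ⟨x, -, hx⟩ := existsUnique_compl a'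
  rw [hf, hx f hf', hx a ha]

theorem eq_zero_of_padd_eq_self {a c : E} (h : padd a c = some a) : c = 0 := by
  obtain ⟨a', ha, -⟩ := existsUnique_compl a
  rw [padd_comm] at h
  obtain ⟨f, hf, hf'⟩ := assoc_left h ha
  rw [ha] at hf
  obtain rfl := Option.some.inj hf
  exact eq_zero_of_padd_one c (by rw [hf']; rfl)

theorem eq_zero_of_padd_eq_zero {a b : E} (h : padd a b = some 0) : b = 0 := by
  have h1 : padd (0 : E) 1 = some 1 := by rw [padd_comm, padd_zero]
  obtain ⟨f, hf, -⟩ := assoc_left h h1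
  exact eq_zero_of_padd_one b (by rw [hf]; rfl)

/-- The order of an effect algebra: `a ≤ b` iff `a + c = b` for some `c`. -/
instance instPartialOrder : PartialOrder E where
  le a b := ∃ c, padd a c = some b
  le_refl a := ⟨0, padd_zero a⟩
  le_trans := by
    rintro a b c ⟨d, hd⟩ ⟨e, he⟩
    obtain ⟨f, -, hf⟩ := assoc_left hd he
    exact ⟨f, hf⟩
  le_antisymm := by
    rintro a b ⟨c, hc⟩ ⟨d, hd⟩
    obtain ⟨f, hf, hf'⟩ := assoc_left hc hd
    rw [eq_zero_of_padd_eq_self hf'] at hf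
    rw [eq_zero_of_padd_eq_zero hf, padd_zero] at hd
    exact (Option.some.inj hd).symm

end Order

/-- The Riesz decomposition property (RDP): if `x₁ + x₂ = y₁ + y₂`, then there are
`c₁₁, c₁₂, c₂₁, c₂₂` with `x₁ = c₁₁ + c₁₂`, `x₂ = c₂₁ + c₂₂`, `y₁ = c₁₁ + c₂₁`,
`y₂ = c₁₂ + c₂₂`. -/
def RDP (E : Type*) [EffectAlgebra E] : Prop :=
  ∀ x₁ x₂ y₁ y₂ z : E, padd x₁ x₂ = some z → padd y₁ y₂ = some z →
    ∃ c₁₁ c₁₂ c₂₁ c₂₂ : E,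
      padd c₁₁ c₁₂ = some x₁ ∧ padd c₂₁ c₂₂ = some x₂ ∧
      padd c₁₁ c₂₁ = some y₁ ∧ padd c₁₂ c₂₂ = some y₂

/-- The countable interpolation property of a poset. -/
def CountableInterpolation (P : Type*) [PartialOrder P] : Prop :=
  ∀ a b : ℕ → P, (∀ i j, a i ≤ b j) → ∃ c : P, (∀ i, a i ≤ c) ∧ (∀ j, c ≤ b j)

/-- Monotone σ-completeness: ascending sequences that are bounded above have suprema, and
descending sequences that are bounded below have infima. -/
def MonotoneSigmaComplete (P : Type*) [PartialOrder P] : Prop :=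
  (∀ x : ℕ → P, Monotone x → BddAbove (Set.range x) → ∃ y, IsLUB (Set.range x) y) ∧
  (∀ x : ℕ → P, Antitone x → BddBelow (Set.range x) → ∃ y, IsGLB (Set.range x) y)

/-- The set of all states on `E`: maps `s : E → [0,1]` with `s 1 = 1` and
`s (a + b) = s a + s b` whenever `a + b` is defined. -/
def stateSpace (E : Type*) [EffectAlgebra E] : Set (E → ℝ) :=
  {s | (∀ a, s a ∈ Set.Icc (0 : ℝ) 1) ∧ s 1 = 1 ∧
    ∀ a b c : E, padd a b = some c → s c = s a + s b}

/-- A state is extremal if it is an extreme point of the convex set of all states. -/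
def IsExtremalState {E : Type*} [EffectAlgebra E] (s : E → ℝ) : Prop :=
  s ∈ (stateSpace E).extremePoints ℝ

/-- `s` is the σ-convex combination `∑ i, w i • t i`, the sum being taken pointwise. -/
def IsSigmaConvexCombination {E ι : Type*} (w : ι → ℝ) (t : ι → E → ℝ) (s : E → ℝ) : Prop :=
  (∀ i, 0 ≤ w i) ∧ HasSum w 1 ∧ ∀ a : E, HasSum (fun i => w i * t i a) (s a)

/-- A Jauch–Piron state: a state `s` such that whenever `s a = s b = 1`, there is `c ≤ a, b`
with `s c = 1`. -/
def IsJauchPironState {E : Type*} [EffectAlgebra E] (s : E → ℝ) : Prop :=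
  s ∈ stateSpace E ∧
    ∀ a b : E, s a = 1 → s b = 1 → ∃ c : E, c ≤ a ∧ c ≤ b ∧ s c = 1

end EffectAlgebra

namespace EffectAlgebra

section Interpolation

variable {E : Type*} [EffectAlgebra E]

/-! Two Riesz refinements, with a cancellation in between, give interpolation for two elements below
two. Under monotone σ-completeness this extends to countable families: infima of descending
interpolants handle countably many upper bounds, then suprema of ascending ones handle countably
many lower bounds. The Jauch–Piron property also comes from a refinement: for `a + a' = 1 = b + b'`,
the common part of `a` and `b` differs from `b` only by a piece of `a'`, which is null when `s a =
1`. -/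

/-- Both `b` and `c` are orthosupplements of `a + d'`. -/
theorem padd_left_cancel {a b c d : E} (h₁ : padd a b = some d) (h₂ : padd a c = some d) :
    b = c := by
  obtain ⟨d', hd, -⟩ := existsUnique_compl d
  rw [padd_comm] at h₁ h₂
  obtain ⟨f, hf, hbf⟩ := assoc_left h₁ hd
  obtain ⟨g, hg, hcg⟩ := assoc_left h₂ hd
  obtain rfl : f = g := Option.some.inj (hf.symm.trans hg)
  rw [padd_comm] at hbf hcg
  exact (existsUnique_compl f).unique hbf hcg

/-- Effect algebras with (RDP) have the finite interpolation property. -/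
theorem RDP.exists_between (hE : RDP E) {a₁ a₂ b₁ b₂ : E} (h₁₁ : a₁ ≤ b₁) (h₁₂ : a₁ ≤ b₂)
    (h₂₁ : a₂ ≤ b₁) (h₂₂ : a₂ ≤ b₂) : ∃ c, a₁ ≤ c ∧ a₂ ≤ c ∧ c ≤ b₁ ∧ c ≤ b₂ := by
  obtain ⟨x, hx⟩ := h₁₁
  obtain ⟨u, hu⟩ := h₁₂
  obtain ⟨y, hy⟩ := h₂₁
  obtain ⟨v, hv⟩ := h₂₂
  obtain ⟨r, p, q, t, hrp, hqt, hrq, -⟩ := hE _ _ _ _ _ hx hy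
  obtain ⟨f, hf, hrf⟩ := assoc_left hrp hu
  obtain ⟨g, hg, hrg⟩ := assoc_left hrq hv
  -- Cancelling `r` from the two expansions of `b₂` gives `p + u = q + v`.
  obtain rfl := padd_left_cancel hrf hrg
  -- `q` splits as `d + q'` with `d ≤ p` and `q' ≤ u`; the interpolant is `a₁ + q'`.
  obtain ⟨d, p', q', u', hp, hu', hq, -⟩ := hE _ _ _ _ _ hf hg
  obtain ⟨c, hc, hcb₂⟩ := assoc_right hu' hu
  refine ⟨c, ⟨q', hc⟩, ?_, ?_, ⟨u', hcb₂⟩⟩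
  -- With `e = r + d`: `c = (e + p') + q' = (e + q') + p' = a₂ + p'`.
  · obtain ⟨e, he, hea⟩ := assoc_right hp hrp
    obtain ⟨k, hk, hek⟩ := assoc_left hea hc
    rw [padd_comm] at hk
    obtain ⟨l, hl, hlc⟩ := assoc_right hk hek
    obtain ⟨m, hm, hrm⟩ := assoc_left he hl
    obtain rfl : m = q := Option.some.inj (hm.symm.trans hq)
    obtain rfl : l = a₂ := Option.some.inj (hrm.symm.trans hrq)
    exact ⟨p', hlc⟩
  -- Since `x = q + t = q' + (d + t)`, `b₁ = a₁ + x = c + (d + t)`.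
  · rw [padd_comm] at hq
    obtain ⟨k, -, hqk⟩ := assoc_left hq hqt
    obtain ⟨l, hl, hlb⟩ := assoc_right hqk hx
    obtain rfl : l = c := Option.some.inj (hl.symm.trans hc)
    exact ⟨k, hlb⟩

/-- Interpolating repeatedly below the previous interpolant and the next `b n` yields a descending
sequence above `a₁` and `a₂`; its infimum works. -/
theorem RDP.exists_between_seq (hE : RDP E) (hσ : MonotoneSigmaComplete E) {a₁ a₂ : E}
    {b : ℕ → E} (h₁ : ∀ j, a₁ ≤ b j) (h₂ : ∀ j, a₂ ≤ b j) :
    ∃ c, a₁ ≤ c ∧ a₂ ≤ c ∧ ∀ j, c ≤ b j := by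
  have hstep : ∀ (n : ℕ) (d : {d : E // a₁ ≤ d ∧ a₂ ≤ d}),
      ∃ e : {e : E // a₁ ≤ e ∧ a₂ ≤ e}, e.1 ≤ d.1 ∧ e.1 ≤ b n := by
    rintro n ⟨d, hd₁, hd₂⟩
    obtain ⟨e, he₁, he₂, hed, heb⟩ := hE.exists_between hd₁ (h₁ n) hd₂ (h₂ n)
    exact ⟨⟨e, he₁, he₂⟩, hed, heb⟩
  choose F hF using hstep
  let D : ℕ → {d : E // a₁ ≤ d ∧ a₂ ≤ d} := fun n =>
    Nat.rec ⟨b 0, h₁ 0, h₂ 0⟩ (fun n d => F n d) n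
  have hD : ∀ n, (D (n + 1)).1 ≤ (D n).1 ∧ (D (n + 1)).1 ≤ b n := fun n => hF n (D n)
  obtain ⟨c, hc⟩ := hσ.2 (fun n => (D n).1) (antitone_nat_of_succ_le fun n => (hD n).1)
    ⟨a₁, by rintro _ ⟨n, rfl⟩; exact (D n).2.1⟩
  refine ⟨c, hc.2 ?_, hc.2 ?_, fun j => (hc.1 ⟨j + 1, rfl⟩).trans (hD j).2⟩
  · rintro _ ⟨n, rfl⟩; exact (D n).2.1
  · rintro _ ⟨n, rfl⟩; exact (D n).2.2

/-- The dual recursion absorbs one `a n` at a time while staying below every `b j`, and ends with a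
supremum. -/
theorem RDP.countableInterpolation (hE : RDP E) (hσ : MonotoneSigmaComplete E) :
    CountableInterpolation E := by
  intro a b hab
  have hstep : ∀ (n : ℕ) (d : {d : E // ∀ j, d ≤ b j}),
      ∃ e : {e : E // ∀ j, e ≤ b j}, d.1 ≤ e.1 ∧ a n ≤ e.1 := by
    rintro n ⟨d, hd⟩
    obtain ⟨e, hde, hae, heb⟩ := hE.exists_between_seq hσ hd (hab n)
    exact ⟨⟨e, heb⟩, hde, hae⟩
  choose F hF using hstep
  let D : ℕ → {d : E // ∀ j, d ≤ b j} := fun n => Nat.rec ⟨a 0, hab 0⟩ (fun n d => F n d) n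
  have hD : ∀ n, (D n).1 ≤ (D (n + 1)).1 ∧ a n ≤ (D (n + 1)).1 := fun n => hF n (D n)
  obtain ⟨c, hc⟩ := hσ.1 (fun n => (D n).1) (monotone_nat_of_le_succ fun n => (hD n).1)
    ⟨b 0, by rintro _ ⟨n, rfl⟩; exact (D n).2 0⟩
  refine ⟨c, fun i => (hD i).2.trans (hc.1 ⟨i + 1, rfl⟩), fun j => hc.2 ?_⟩
  rintro _ ⟨n, rfl⟩
  exact (D n).2 j

end Interpolation

section States

variable {E : Type*} [EffectAlgebra E]

/-- A σ-convex combination of states is a state. -/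
theorem IsSigmaConvexCombination.mem_stateSpace {ι : Type*} {w : ι → ℝ} {t : ι → E → ℝ}
    {s : E → ℝ} (h : IsSigmaConvexCombination w t s) (ht : ∀ i, t i ∈ stateSpace E) :
    s ∈ stateSpace E := by
  obtain ⟨hw, hw1, hs⟩ := h
  refine ⟨fun a => ⟨(hs a).nonneg fun i => mul_nonneg (hw i) ((ht i).1 a).1,
    hasSum_le (fun i => mul_le_of_le_one_right (hw i) ((ht i).1 a).2) (hs a) hw1⟩, ?_, ?_⟩
  · refine (hs 1).unique ?_
    simpa only [(ht _).2.1, mul_one] using hw1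
  · intro a b c habc
    refine (hs c).unique ?_
    simpa only [(ht _).2.2 a b c habc, mul_add] using (hs a).add (hs b)

/-- Every state on an effect algebra with (RDP) is Jauch–Piron: a Riesz refinement of
`a + a' = b + b'` contains a common lower bound of `a` and `b` of full measure. -/
theorem RDP.isJauchPironState (hE : RDP E) {s : E → ℝ} (hs : s ∈ stateSpace E) :
    IsJauchPironState s := by
  refine ⟨hs, fun a b ha hb => ?_⟩
  obtain ⟨h01, h1, hadd⟩ := hs
  obtain ⟨a', ha', -⟩ := existsUnique_compl a
  obtain ⟨b', hb', -⟩ := existsUnique_compl b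
  obtain ⟨c, d, e, f, hcd, hef, hce, -⟩ := hE _ _ _ _ _ ha' hb'
  refine ⟨c, ⟨d, hcd⟩, ⟨e, hce⟩, ?_⟩
  -- `s a' = 0` and `a' = e + f` force `s e = 0`, so `s c = s b = 1`.
  have := hadd _ _ _ ha'
  have := hadd _ _ _ hef
  have := hadd _ _ _ hce
  have := (h01 e).1
  have := (h01 f).1
  linarith

end States

end EffectAlgebra

theorem mainTheorem5 {E : Type*} [EffectAlgebra E] (hRDP : EffectAlgebra.RDP E) :
    (EffectAlgebra.MonotoneSigmaComplete E → EffectAlgebra.CountableInterpolation E) ∧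
    (EffectAlgebra.CountableInterpolation E →
      ∀ {ι : Type*} [Countable ι] (w : ι → ℝ) (t : ι → E → ℝ) (s : E → ℝ),
        (∀ i, EffectAlgebra.IsExtremalState (t i)) →
        EffectAlgebra.IsSigmaConvexCombination w t s →
        EffectAlgebra.IsJauchPironState s) := by
  refine ⟨hRDP.countableInterpolation, fun _ ι _ w t s ht h => ?_⟩
  exact hRDP.isJauchPironState (h.mem_stateSpace fun i => (ht i).1)
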